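/- Let $K$ be a field of characteristic different from $2$ and $3$. For $\gamma\in\{1,-1\}$ let $\mathbb O=\mathbb O_\gamma$ be the octonion algebra over $K$ obtained by the Cayley--Dickson doubling with parameter $\gamma$ from the quaternion algebra $\mathbb H$ over $K$ with basis $1,i,j,k$, $i^2=j^2=k^2=-1$, $ij=-ji=k$: that is, $\mathbb O=\mathbb H\oplus\mathbb H\ell$ with $$(p+q\ell)(r+s\ell)=(pr+\gamma\,\overline s q)+(sp+q\overline r)\ell,\qquad \overline{p+q\ell}=\overline p-q\ell .$$ ($\mathbb O_1$ is the split octonion algebra; $\mathbb O_{-1}$ is the octonion algebra with the standard basis $1,e_1,\dots,e_7$, $e_i^2=-1$.) For $n\ge 1$ let $J$ be the involution $(a_{ij})\mapsto(\overline{a_{ji}})$ of the algebra $M_n(\mathbb O)$ of $n\times n$ matrices over $\mathbb O$. Consider the algebra of Hermitian matrices $\{X\in M_n(\mathbb O): J(X)=X\}$ with the product $X\circ Y=\frac12(XY+YX)$, and the algebra of skew-Hermitian matrices $\{X\in M_n(\mathbb O): J(X)=-X\}$ with the product $[X,Y]=XY-YX$. Then both algebras are central simple over $K$: each of them is simple (it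 has nonzero multiplication and no two-sided ideals other than $0$ and itself, $0$ being a proper ideal), and its centroid, i.e. the set of all maps $\varphi$ of the algebra into itself that are additive and satisfy $\varphi(xy)=\varphi(x)y=x\varphi(y)$ for all $x,y$, consists precisely of the multiplications by scalars from $K$, hence is isomorphic to $K$. -/

import Mathlib

/-! ### Nonassociative algebras with involution -/

/-- An involution on a (not necessarily associative) `K`-algebra `A`: a `K`-linear map `j : A → A`
with `j ∘ j = id` and `j (x * y) = j y * j x`. -/
structure AlgInvolution (K A : Type*) [Field K] [NonUnitalNonAssocRing A] [Module K A] where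
  toLinearMap : A →ₗ[K] A
  invol : ∀ x, toLinearMap (toLinearMap x) = x
  map_mul : ∀ x y, toLinearMap (x * y) = toLinearMap y * toLinearMap x

namespace AlgInvolution

variable {K A : Type*} [Field K] [NonUnitalNonAssocRing A] [Module K A]

/-- `sym⁺(A, j)`: the subspace of `j`-symmetric elements. -/
def symPlus (j : AlgInvolution K A) : Submodule K A where
  carrier := {x | j.toLinearMap x = x}
  add_mem' {x y} hx hy := by
    simp only [Set.mem_ofPred_eq] at *
    rw [map_add, hx, hy]
  zero_mem' := map_zero _
  smul_mem' c x hx := by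
    simp only [Set.mem_ofPred_eq] at *
    rw [map_smul, hx]

/-- `sym⁻(A, j)`: the subspace of `j`-skew-symmetric elements. -/
def symMinus (j : AlgInvolution K A) : Submodule K A where
  carrier := {x | j.toLinearMap x = -x}
  add_mem' {x y} hx hy := by
    simp only [Set.mem_ofPred_eq] at *
    rw [map_add, hx, hy, neg_add]
  zero_mem' := by simp
  smul_mem' c x hx := by
    simp only [Set.mem_ofPred_eq] at *
    rw [map_smul, hx, smul_neg]

theorem mem_symPlus {j : AlgInvolution K A} {x : A} :
    x ∈ j.symPlus ↔ j.toLinearMap x = x := Iff.rfl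

theorem mem_symMinus {j : AlgInvolution K A} {x : A} :
    x ∈ j.symMinus ↔ j.toLinearMap x = -x := Iff.rfl

/-- The product on `sym⁺(A, j)` is the anticommutator `x ∘ y = (1/2) (x y + y x)`. -/
instance (j : AlgInvolution K A) : Mul j.symPlus where
  mul x y := ⟨(2⁻¹ : K) • ((x : A) * y + (y : A) * x), by
    have hx := mem_symPlus.1 x.2
    have hy := mem_symPlus.1 y.2
    rw [mem_symPlus, map_smul, map_add, j.map_mul, j.map_mul, hx, hy, add_comm]⟩

/-- The product on `sym⁻(A, j)` is the commutator `[x, y] = x y - y x`. -/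
instance (j : AlgInvolution K A) : Mul j.symMinus where
  mul x y := ⟨(x : A) * y - (y : A) * x, by
    have hx := mem_symMinus.1 x.2
    have hy := mem_symMinus.1 y.2
    rw [mem_symMinus, map_sub, j.map_mul, j.map_mul, hx, hy]
    simp⟩

theorem coe_mul_symPlus (j : AlgInvolution K A) (x y : j.symPlus) :
    ((x * y : j.symPlus) : A) = (2⁻¹ : K) • ((x : A) * y + (y : A) * x) := rfl

theorem coe_mul_symMinus (j : AlgInvolution K A) (x y : j.symMinus) :
    ((x * y : j.symMinus) : A) = (x : A) * y - (y : A) * x := rfl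

instance (j : AlgInvolution K A) : NonUnitalNonAssocRing j.symPlus where
  left_distrib x y z := by
    ext
    simp only [coe_mul_symPlus, Submodule.coe_add, mul_add, add_mul, smul_add]
    abel
  right_distrib x y z := by
    ext
    simp only [coe_mul_symPlus, Submodule.coe_add, mul_add, add_mul, smul_add]
    abel
  zero_mul x := by ext; simp [coe_mul_symPlus]
  mul_zero x := by ext; simp [coe_mul_symPlus]

instance (j : AlgInvolution K A) : NonUnitalNonAssocRing j.symMinus where
  left_distrib x y z := by
    ext
    simp only [coe_mul_symMinus, Submodule.coe_add, mul_add, add_mul]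
    abel
  right_distrib x y z := by
    ext
    simp only [coe_mul_symMinus, Submodule.coe_add, mul_add, add_mul]
    abel
  zero_mul x := by ext; simp [coe_mul_symMinus]
  mul_zero x := by ext; simp [coe_mul_symMinus]

variable [IsScalarTower K A A] [SMulCommClass K A A]

instance (j : AlgInvolution K A) : IsScalarTower K j.symPlus j.symPlus where
  smul_assoc c x y := by
    ext
    simp only [smul_eq_mul, coe_mul_symPlus, Submodule.coe_smul, smul_mul_assoc, mul_smul_comm,
      smul_add, smul_comm c (2⁻¹ : K)]

instance (j : AlgInvolution K A) : SMulCommClass K j.symPlus j.symPlus where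
  smul_comm c x y := by
    ext
    simp only [smul_eq_mul, coe_mul_symPlus, Submodule.coe_smul, smul_mul_assoc, mul_smul_comm,
      smul_add, smul_comm c (2⁻¹ : K)]

instance (j : AlgInvolution K A) : IsScalarTower K j.symMinus j.symMinus where
  smul_assoc c x y := by
    ext
    simp only [smul_eq_mul, coe_mul_symMinus, Submodule.coe_smul, smul_mul_assoc, mul_smul_comm,
      smul_sub]

instance (j : AlgInvolution K A) : SMulCommClass K j.symMinus j.symMinus where
  smul_comm c x y := by
    ext
    simp only [smul_eq_mul, coe_mul_symMinus, Submodule.coe_smul, smul_mul_assoc, mul_smul_comm,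
      smul_sub]

end AlgInvolution

/-! ### Central simple nonassociative algebras -/

/-- A (not necessarily associative or unital) `K`-algebra `A` is central simple if it is simple,
i.e. its multiplication is nonzero and it has no two-sided ideals besides `0` and `A ≠ 0`, and if
its centroid (the maps `A → A` commuting with all left and right multiplications) consists
precisely of the multiplications by the scalars from `K`, distinct scalars giving distinct maps. -/
structure IsCentralSimpleAlg (K A : Type*) [Field K] [NonUnitalNonAssocRing A] [Module K A]
    [IsScalarTower K A A] [SMulCommClass K A A] : Prop where
  exists_mul_ne_zero : ∃ x y : A, x * y ≠ 0
  simple : IsSimpleRing A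
  central : Function.Bijective (Module.toCentroidHom : K →+* CentroidHom A)

/-! ### Octonions -/

/-- The octonion algebra over `K` obtained from the quaternion algebra `ℍ[K]` with basis
`1, i, j, k` (`i² = j² = k² = -1`) by the Cayley-Dickson doubling with parameter `γ`:
`p + q ℓ` with `p q : ℍ[K]` and `ℓ² = γ`.

For `γ = 1` the norm form `N(p) - γ N(q)` is isotropic, and this is the split octonion algebra.
For `γ = -1` this is the algebra with the standard basis `1, e₁, …, e₇`, `eᵢ² = -1`. -/
@[ext]
structure Octonion (K : Type*) [Field K] (γ : K) where
  fst : Quaternion K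
  snd : Quaternion K

namespace Octonion

variable {K : Type*} [Field K] {γ : K}

instance : Zero (Octonion K γ) := ⟨⟨0, 0⟩⟩
instance : One (Octonion K γ) := ⟨⟨1, 0⟩⟩
instance : Add (Octonion K γ) := ⟨fun x y => ⟨x.fst + y.fst, x.snd + y.snd⟩⟩
instance : Neg (Octonion K γ) := ⟨fun x => ⟨-x.fst, -x.snd⟩⟩
instance : Sub (Octonion K γ) := ⟨fun x y => ⟨x.fst - y.fst, x.snd - y.snd⟩⟩
instance {S : Type*} [SMul S (Quaternion K)] : SMul S (Octonion K γ) :=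
  ⟨fun c x => ⟨c • x.fst, c • x.snd⟩⟩

/-- `(p + q ℓ) (r + s ℓ) = (p r + γ s̄ q) + (s p + q r̄) ℓ`. -/
instance : Mul (Octonion K γ) :=
  ⟨fun x y => ⟨x.fst * y.fst + γ • (star y.snd * x.snd), y.snd * x.fst + x.snd * star y.fst⟩⟩

/-- The standard conjugation: the conjugate of `p + q ℓ` is `p̄ - q ℓ`. -/
instance : Star (Octonion K γ) := ⟨fun x => ⟨star x.fst, -x.snd⟩⟩

@[simp] theorem fst_zero : (0 : Octonion K γ).fst = 0 := rfl
@[simp] theorem snd_zero : (0 : Octonion K γ).snd = 0 := rfl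
@[simp] theorem fst_one : (1 : Octonion K γ).fst = 1 := rfl
@[simp] theorem snd_one : (1 : Octonion K γ).snd = 0 := rfl
@[simp] theorem fst_add (x y : Octonion K γ) : (x + y).fst = x.fst + y.fst := rfl
@[simp] theorem snd_add (x y : Octonion K γ) : (x + y).snd = x.snd + y.snd := rfl
@[simp] theorem fst_neg (x : Octonion K γ) : (-x).fst = -x.fst := rfl
@[simp] theorem snd_neg (x : Octonion K γ) : (-x).snd = -x.snd := rfl
@[simp] theorem fst_sub (x y : Octonion K γ) : (x - y).fst = x.fst - y.fst := rfl
@[simp] theorem snd_sub (x y : Octonion K γ) : (x - y).snd = x.snd - y.snd := rfl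
@[simp] theorem fst_smul {S : Type*} [SMul S (Quaternion K)] (c : S) (x : Octonion K γ) :
    (c • x).fst = c • x.fst := rfl
@[simp] theorem snd_smul {S : Type*} [SMul S (Quaternion K)] (c : S) (x : Octonion K γ) :
    (c • x).snd = c • x.snd := rfl
@[simp] theorem fst_mul (x y : Octonion K γ) :
    (x * y).fst = x.fst * y.fst + γ • (star y.snd * x.snd) := rfl
@[simp] theorem snd_mul (x y : Octonion K γ) :
    (x * y).snd = y.snd * x.fst + x.snd * star y.fst := rfl
@[simp] theorem fst_star (x : Octonion K γ) : (star x).fst = star x.fst := rfl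
@[simp] theorem snd_star (x : Octonion K γ) : (star x).snd = -x.snd := rfl

theorem toProd_injective :
    Function.Injective (fun x : Octonion K γ => (x.fst, x.snd)) := by
  intro x y h
  exact Octonion.ext (congrArg Prod.fst h) (congrArg Prod.snd h)

instance : AddCommGroup (Octonion K γ) :=
  toProd_injective.addCommGroup _ rfl (fun _ _ => rfl) (fun _ => rfl) (fun _ _ => rfl)
    (fun _ _ => rfl) (fun _ _ => rfl)

instance : Module K (Octonion K γ) :=
  toProd_injective.module K
    { toFun := fun x : Octonion K γ => (x.fst, x.snd), map_zero' := rfl, map_add' := fun _ _ => rfl }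
    (fun _ _ => rfl)

instance : NonAssocRing (Octonion K γ) where
  left_distrib x y z := by
    ext1 <;> simp only [fst_mul, snd_mul, fst_add, snd_add, star_add, mul_add, add_mul, smul_add] <;>
      abel
  right_distrib x y z := by
    ext1 <;> simp only [fst_mul, snd_mul, fst_add, snd_add, mul_add, add_mul, smul_add] <;>
      abel
  zero_mul x := by ext1 <;> simp
  mul_zero x := by ext1 <;> simp
  one_mul x := by ext1 <;> simp
  mul_one x := by ext1 <;> simp

instance : IsScalarTower K (Octonion K γ) (Octonion K γ) where
  smul_assoc c x y := by
    ext1 <;> simp only [smul_eq_mul, fst_mul, snd_mul, fst_smul, snd_smul, smul_mul_assoc,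
      mul_smul_comm, smul_add, smul_comm c γ]

theorem star_smul' (c : K) (x : Octonion K γ) : star (c • x) = c • star x := by
  ext1
  · simp only [fst_star, fst_smul, Quaternion.star_smul]
  · simp only [snd_star, snd_smul, smul_neg]

instance : SMulCommClass K (Octonion K γ) (Octonion K γ) where
  smul_comm c x y := by
    ext1 <;> simp only [smul_eq_mul, fst_mul, snd_mul, fst_smul, snd_smul, smul_mul_assoc,
      mul_smul_comm, smul_add, smul_comm c γ, Quaternion.star_smul]

instance : StarRing (Octonion K γ) where
  star_involutive x := by ext1 <;> simp
  star_add x y := by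
    ext1
    · simp
    · simp only [snd_star, snd_add, neg_add]
  star_mul x y := by
    ext1
    · simp [Quaternion.star_smul]
    · simp only [snd_star, snd_mul, fst_star, star_star]
      simp [add_comm]

end Octonion

/-- The involution `J : (a_{ij}) ↦ (conjugate of a_{ji})` on `M_n(𝕆)`. -/
def octonionMatrixInvolution (K : Type*) [Field K] (γ : K) (n : ℕ) :
    AlgInvolution K (Matrix (Fin n) (Fin n) (Octonion K γ)) where
  toLinearMap :=
    { toFun := fun X => X.conjTranspose
      map_add' := fun X Y => Matrix.conjTranspose_add X Y
      map_smul' := fun c X => by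
        ext1 i j
        simp [Matrix.conjTranspose_apply, Octonion.star_smul'] }
  invol X := Matrix.conjTranspose_conjTranspose X
  map_mul X Y := Matrix.conjTranspose_mul X Y

/-- The algebra `sym⁺(M_n(𝕆), J)` of Hermitian octonionic matrices with the product
`X ∘ Y = (1/2) (X Y + Y X)`. -/
abbrev HermitianOctonion (K : Type*) [Field K] (γ : K) (n : ℕ) : Type _ :=
  (octonionMatrixInvolution K γ n).symPlus

/-- The algebra `sym⁻(M_n(𝕆), J)` of skew-Hermitian octonionic matrices with the product
`[X, Y] = X Y - Y X`. -/
abbrev SkewHermitianOctonion (K : Type*) [Field K] (γ : K) (n : ℕ) : Type _ :=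
  (octonionMatrixInvolution K γ n).symMinus

/-!
Left multiplications generate a ring that preserves every ideal and commutes with the centroid, and
on skew-Hermitian matrices this ring is large. Commutators with `a • 1`, `a` imaginary, act
entrywise as twice the cross product with `a`, and `a × (a × x) = ⟨a, x⟩ a - ⟨a, a⟩ x` puts every
rank one map of the imaginary octonions into the ring they generate. A nonzero ideal therefore
contains `S ⊗ a` for some `S ≠ 0` and all imaginary `a`. The possible `S` form a Jordan ideal of the
symmetric matrices over `K`, because `[T ⊗ i, S ⊗ j] = (T S + S T) ⊗ k`. Peirce projections show
that a nonzero Jordan ideal of Hermitian matrices contains `1`, both over `K` and over the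
octonions. Hence both algebras are simple.

In a simple algebra, an element of the centroid is determined by its value at one nonzero `e`. For
Hermitian matrices `e` is a diagonal idempotent `E_pp`: its Peirce space `{x | x ∘ e = x}` is the
line `K e`. For skew-Hermitian matrices `e = 1 ⊗ i`: a rank one map fixes `e`, hence also `φ e`,
which is therefore of the form `S ⊗ i`, and `S` commutes with all symmetric and all skew-symmetric
matrices, so it is a scalar.
-/

/-! ### The centroid of a simple algebra -/

section NonUnitalNonAssocRing

variable {A : Type*} [NonUnitalNonAssocRing A]

/-- The kernel of an element of the centroid, as a two-sided ideal. -/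
def centroidHomKer (φ : CentroidHom A) : TwoSidedIdeal A :=
  TwoSidedIdeal.mk' {x | φ x = 0} (map_zero φ)
    (fun {x y} (hx : φ x = 0) (hy : φ y = 0) => show φ (x + y) = 0 by
      rw [map_add, hx, hy, add_zero])
    (fun {x} (hx : φ x = 0) => show φ (-x) = 0 by rw [map_neg, hx, neg_zero])
    (fun {x y} (hy : φ y = 0) => show φ (x * y) = 0 by rw [map_mul_left, hy, mul_zero])
    (fun {x y} (hx : φ x = 0) => show φ (x * y) = 0 by rw [map_mul_right, hx, zero_mul])

theorem mem_centroidHomKer {φ : CentroidHom A} {x : A} : x ∈ centroidHomKer φ ↔ φ x = 0 :=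
  TwoSidedIdeal.mem_mk' _ _ _ _ _ _ _

theorem centroidHom_eq_zero_of_apply_eq_zero [IsSimpleRing A] {φ : CentroidHom A} {e : A}
    (he : e ≠ 0) (hφ : φ e = 0) : φ = 0 := by
  have hker : centroidHomKer φ = ⊤ := (eq_bot_or_eq_top _).resolve_left fun hbot =>
    he ((TwoSidedIdeal.mem_bot A).1 (hbot ▸ mem_centroidHomKer.2 hφ))
  ext x
  exact mem_centroidHomKer.1 (hker ▸ TwoSidedIdeal.mem_top A)

theorem exists_mem_ne_zero_of_ne_bot {I : TwoSidedIdeal A} (hI : I ≠ ⊥) : ∃ x ∈ I, x ≠ 0 := by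
  by_contra! h
  exact hI (eq_bot_iff.2 fun x hx => (TwoSidedIdeal.mem_bot A).2 (h x hx))

end NonUnitalNonAssocRing

theorem IsCentralSimpleAlg.of_eigenvector {K A : Type*} [Field K] [NonUnitalNonAssocRing A]
    [Module K A] [IsScalarTower K A A] [SMulCommClass K A A] [IsSimpleRing A]
    (hmul : ∃ x y : A, x * y ≠ 0) {e : A} (he : e ≠ 0)
    (heig : ∀ φ : CentroidHom A, ∃ c : K, φ e = c • e) : IsCentralSimpleAlg K A where
  exists_mul_ne_zero := hmul
  simple := inferInstance
  central := by
    refine ⟨fun c d hcd => smul_left_injective K he (DFunLike.congr_fun hcd e), fun φ => ?_⟩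
    obtain ⟨c, hc⟩ := heig φ
    refine ⟨c, (sub_eq_zero.1 (centroidHom_eq_zero_of_apply_eq_zero he ?_)).symm⟩
    exact sub_eq_zero.2 hc

/-! ### Jordan ideals of Hermitian matrices -/

section Jordan

open Matrix

variable {K R n : Type*} [Field K] [NonAssocRing R] [DecidableEq n]

theorem anticommutator_single_one_apply [Fintype n] (X : Matrix n n R) (p r s : n) :
    (X * single p p 1 + single p p 1 * X : Matrix n n R) r s =
      (if s = p then X r s else 0) + if r = p then X r s else 0 := by
  rw [Matrix.add_apply]
  congr 1
  · split_ifs with hs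
    · rw [hs, mul_single_apply_same, mul_one]
    · exact mul_single_apply_of_ne _ _ _ _ _ hs X
  · split_ifs with hr
    · rw [hr, single_mul_apply_same, one_mul]
    · exact single_mul_apply_of_ne _ _ _ _ _ hr X

variable [StarRing R]

theorem isHermitian_single_one (p : n) : (single p p (1 : R)).IsHermitian := by
  rw [IsHermitian, conjTranspose_single, star_one]

theorem isHermitian_single_add_single_star (p q : n) (b : R) :
    (single p q b + single q p (star b)).IsHermitian := by
  rw [IsHermitian, conjTranspose_add, conjTranspose_single, conjTranspose_single, star_star,
    add_comm]

variable [Module K R] [Fintype n]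

/-- A space of matrices is Jordan stable if it contains all anticommutators of its elements with
Hermitian matrices. The Jordan stable spaces of Hermitian matrices are the ideals of the Jordan
algebra of Hermitian matrices. -/
def IsJordanStable (J : Submodule K (Matrix n n R)) : Prop :=
  ∀ X ∈ J, ∀ T : Matrix n n R, T.IsHermitian → X * T + T * X ∈ J

namespace IsJordanStable

variable {J : Submodule K (Matrix n n R)} {p q : n}

theorem single_apply_self_mem [NeZero (2 : K)] (hJ : IsJordanStable J) {X : Matrix n n R}
    (hX : X ∈ J) (p : n) : single p p (X p p) ∈ J := by
  have hE := isHermitian_single_one (R := R) p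
  -- Anticommutation with `E_pp` multiplies entries by `λ = 0, 1, 2`; `λ ^ 2 - λ` detects `λ = 2`.
  have hmem := J.sub_mem (hJ _ (hJ X hX _ hE) _ hE) (hJ X hX _ hE)
  refine (J.smul_mem_iff (two_ne_zero (α := K))).1 ?_
  convert hmem using 1
  ext r s
  simp only [Matrix.sub_apply, anticommutator_single_one_apply, Matrix.smul_apply, two_smul,
    single_apply]
  by_cases hr : r = p <;> by_cases hs : s = p <;> simp [hr, hs, Ne.symm]

theorem single_add_single_mem (hJ : IsJordanStable J) {X : Matrix n n R} (hX : X ∈ J)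
    (hpq : p ≠ q) : single p q (X p q) + single q p (X q p) ∈ J := by
  convert hJ _ (hJ X hX _ (isHermitian_single_one p)) _ (isHermitian_single_one q) using 1
  ext r s
  rw [Matrix.add_apply (single p q _)]
  simp only [anticommutator_single_one_apply, single_apply]
  by_cases hrp : r = p <;> by_cases hsp : s = p <;> by_cases hrq : r = q <;>
    by_cases hsq : s = q <;> simp_all [eq_comm]

theorem single_one_mem [NeZero (2 : K)] (hJ : IsJordanStable J) (hpq : p ≠ q) {a b : R}
    (hab : a * star b + b * star a = 1) (ha : single p q a + single q p (star a) ∈ J) :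
    single p p 1 ∈ J := by
  have hmem := hJ.single_apply_self_mem
    (hJ _ ha _ (isHermitian_single_add_single_star p q b)) p
  simpa [mul_add, add_mul, hpq, hpq.symm, hab] using hmem

theorem single_one_mem_of_single_one_mem [NeZero (2 : K)] (hJ : IsJordanStable J) {b : R}
    (hb : star b + b = 1) (hp : single p p 1 ∈ J) (q : n) : single q q 1 ∈ J := by
  rcases eq_or_ne q p with rfl | hqp
  · exact hp
  · refine hJ.single_one_mem hqp (a := 1) (b := b) (by rw [star_one, one_mul, mul_one, hb]) ?_
    simpa [mul_add, add_mul, hqp, hqp.symm, add_comm] using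
      hJ _ hp _ (isHermitian_single_add_single_star q p 1)

theorem exists_single_one_mem [NeZero (2 : K)] (hJ : IsJordanStable J)
    (hscalar : ∀ a : R, star a = a → ∃ c : K, a = c • 1)
    (hform : ∀ a : R, a ≠ 0 → ∃ b, a * star b + b * star a = 1)
    {X : Matrix n n R} (hX : X ∈ J) (hX_herm : X.IsHermitian) (hX0 : X ≠ 0) :
    ∃ p, single p p 1 ∈ J := by
  obtain ⟨p, q, hpq0⟩ : ∃ p q, X p q ≠ 0 := by
    by_contra! h
    exact hX0 (Matrix.ext h)
  refine ⟨p, ?_⟩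
  rcases eq_or_ne p q with rfl | hpq
  · obtain ⟨c, hc⟩ := hscalar (X p p) (hX_herm.apply p p)
    have hc0 : c ≠ 0 := by
      rintro rfl
      exact hpq0 (hc.trans (zero_smul K 1))
    refine (J.smul_mem_iff hc0).1 ?_
    rw [smul_single, ← hc]
    exact hJ.single_apply_self_mem hX p
  · obtain ⟨b, hb⟩ := hform (X p q) hpq0
    refine hJ.single_one_mem hpq hb ?_
    rw [hX_herm.apply q p]
    exact hJ.single_add_single_mem hX hpq

theorem one_mem [NeZero (2 : K)] (hJ : IsJordanStable J)
    (hscalar : ∀ a : R, star a = a → ∃ c : K, a = c • 1)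
    (hform : ∀ a : R, a ≠ 0 → ∃ b, a * star b + b * star a = 1)
    {X : Matrix n n R} (hX : X ∈ J) (hX_herm : X.IsHermitian) (hX0 : X ≠ 0) : 1 ∈ J := by
  obtain ⟨p, hp⟩ := hJ.exists_single_one_mem hscalar hform hX hX_herm hX0
  have : Nontrivial R := not_subsingleton_iff_nontrivial.1 fun _ => hX0 (Subsingleton.elim X 0)
  obtain ⟨b, hb⟩ := hform 1 one_ne_zero
  rw [star_one, one_mul, mul_one] at hb
  rw [← sum_single_one]
  exact sum_mem fun q _ => hJ.single_one_mem_of_single_one_mem hb hp q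

end IsJordanStable

end Jordan

/-! ### Octonion arithmetic -/

namespace Octonion

open scoped Quaternion

variable {K : Type*} [Field K] {γ : K}

theorem ext_coord {x y : Octonion K γ}
    (h₁ : x.fst.re = y.fst.re) (h₂ : x.fst.imI = y.fst.imI) (h₃ : x.fst.imJ = y.fst.imJ)
    (h₄ : x.fst.imK = y.fst.imK) (h₅ : x.snd.re = y.snd.re) (h₆ : x.snd.imI = y.snd.imI)
    (h₇ : x.snd.imJ = y.snd.imJ) (h₈ : x.snd.imK = y.snd.imK) : x = y :=
  Octonion.ext (QuaternionAlgebra.ext h₁ h₂ h₃ h₄) (QuaternionAlgebra.ext h₅ h₆ h₇ h₈)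

instance : Nontrivial (Octonion K γ) :=
  ⟨1, 0, fun h => one_ne_zero (congrArg (fun x : Octonion K γ => x.fst.re) h)⟩

variable (K γ) in
/-- The real part of an octonion, that is, its coefficient at `1`. -/
def re : Octonion K γ →ₗ[K] K where
  toFun x := x.fst.re
  map_add' _ _ := rfl
  map_smul' _ _ := rfl

theorem re_apply (x : Octonion K γ) : re K γ x = x.fst.re := rfl

theorem re_star (x : Octonion K γ) : re K γ (star x) = re K γ x := by
  rw [re_apply, re_apply, fst_star, Quaternion.re_star]

variable (K γ) in
/-- The imaginary part `x - re x` of an octonion. -/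
def im : Octonion K γ →ₗ[K] Octonion K γ :=
  LinearMap.id - (re K γ).smulRight 1

theorem im_apply (x : Octonion K γ) : im K γ x = x - re K γ x • 1 := rfl

theorem two_smul_im (x : Octonion K γ) : (2 : K) • im K γ x = x - star x := by
  apply ext_coord <;> simp [im_apply, re_apply] <;> ring

/-- The polarization `⟨x, y⟩` of the norm form `x * star x`, with `⟨x, x⟩ = 2 N(x)`. -/
def polar : Octonion K γ →ₗ[K] Octonion K γ →ₗ[K] K :=
  LinearMap.mk₂ K
    (fun x y => 2 * (x.fst.re * y.fst.re + x.fst.imI * y.fst.imI + x.fst.imJ * y.fst.imJ +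
      x.fst.imK * y.fst.imK) - 2 * γ * (x.snd.re * y.snd.re + x.snd.imI * y.snd.imI +
      x.snd.imJ * y.snd.imJ + x.snd.imK * y.snd.imK))
    (fun _ _ _ => by simp; ring) (fun _ _ _ => by simp; ring)
    (fun _ _ _ => by simp; ring) (fun _ _ _ => by simp; ring)

theorem mul_star_add_mul_star (x y : Octonion K γ) :
    x * star y + y * star x = polar x y • (1 : Octonion K γ) := by
  apply ext_coord <;> simp [polar] <;> ring

theorem eq_re_smul_one_of_star_eq_self [NeZero (2 : K)] {x : Octonion K γ} (hx : star x = x) :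
    x = re K γ x • (1 : Octonion K γ) := by
  have him : (2 : K) • im K γ x = 0 := by rw [two_smul_im, hx, sub_self]
  exact sub_eq_zero.1 ((smul_eq_zero_iff_right two_ne_zero).1 him)

variable (K γ) in
/-- The space of imaginary octonions, those with `star x = -x` when `2 ≠ 0`. -/
def imaginary : Submodule K (Octonion K γ) :=
  LinearMap.ker (re K γ)

theorem im_mem_imaginary (x : Octonion K γ) : im K γ x ∈ imaginary K γ := by
  simp [imaginary, im_apply, re_apply]

theorem im_of_mem_imaginary {a : Octonion K γ} (ha : a ∈ imaginary K γ) : im K γ a = a := by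
  have hre : re K γ a = 0 := ha
  rw [im_apply, hre, zero_smul, sub_zero]

theorem star_eq_neg_of_mem_imaginary {a : Octonion K γ} (ha : a ∈ imaginary K γ) :
    star a = -a := by
  have hre : a.fst.re = 0 := ha
  apply ext_coord <;> simp [hre]

theorem polar_comm (x y : Octonion K γ) : polar x y = polar y x := by
  simp [polar]
  ring

theorem polar_im_left (x y : Octonion K γ) : polar (im K γ x) y = polar x (im K γ y) := by
  simp [polar, im_apply, re_apply]
  ring

theorem polar_star_right {a : Octonion K γ} (ha : a ∈ imaginary K γ) (x : Octonion K γ) :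
    polar a (star x) = -polar a x := by
  have hre : a.fst.re = 0 := ha
  simp [polar, hre]
  ring

theorem exists_polar_ne_zero [NeZero (2 : K)] (hγ : γ ≠ 0) {x : Octonion K γ} (hx : x ≠ 0) :
    ∃ y, polar x y ≠ 0 := by
  by_contra! h
  have h2 : (2 : K) ≠ 0 := two_ne_zero
  apply hx
  apply ext_coord
  · simpa [polar, h2] using h ⟨⟨1, 0, 0, 0⟩, 0⟩
  · simpa [polar, h2] using h ⟨⟨0, 1, 0, 0⟩, 0⟩
  · simpa [polar, h2] using h ⟨⟨0, 0, 1, 0⟩, 0⟩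
  · simpa [polar, h2] using h ⟨⟨0, 0, 0, 1⟩, 0⟩
  · simpa [polar, h2, hγ] using h ⟨0, ⟨1, 0, 0, 0⟩⟩
  · simpa [polar, h2, hγ] using h ⟨0, ⟨0, 1, 0, 0⟩⟩
  · simpa [polar, h2, hγ] using h ⟨0, ⟨0, 0, 1, 0⟩⟩
  · simpa [polar, h2, hγ] using h ⟨0, ⟨0, 0, 0, 1⟩⟩

theorem exists_mul_star_add_mul_star_eq_one [NeZero (2 : K)] (hγ : γ ≠ 0) {x : Octonion K γ}
    (hx : x ≠ 0) : ∃ y, x * star y + y * star x = 1 := by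
  obtain ⟨y, hy⟩ := exists_polar_ne_zero hγ hx
  refine ⟨(polar x y)⁻¹ • y, ?_⟩
  rw [mul_star_add_mul_star, map_smul, smul_eq_mul, inv_mul_cancel₀ hy, one_smul]

theorem exists_imaginary_polar_ne_zero [NeZero (2 : K)] (hγ : γ ≠ 0) {x : Octonion K γ}
    (hx : im K γ x ≠ 0) : ∃ a ∈ imaginary K γ, polar a x ≠ 0 := by
  obtain ⟨y, hy⟩ := exists_polar_ne_zero hγ hx
  refine ⟨im K γ y, im_mem_imaginary y, ?_⟩
  rwa [polar_im_left, polar_comm]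

/-! ### The multiplication ring of the imaginary octonions -/

variable (γ) in
/-- The quaternion unit `i`. -/
def unitI : Octonion K γ := ⟨⟨0, 1, 0, 0⟩, 0⟩

variable (γ) in
/-- The quaternion unit `j`. -/
def unitJ : Octonion K γ := ⟨⟨0, 0, 1, 0⟩, 0⟩

variable (γ) in
/-- The quaternion unit `k`. -/
def unitK : Octonion K γ := ⟨⟨0, 0, 0, 1⟩, 0⟩

theorem unitI_mem_imaginary : unitI γ ∈ imaginary K γ := rfl
theorem unitJ_mem_imaginary : unitJ γ ∈ imaginary K γ := rfl
theorem unitK_mem_imaginary : unitK γ ∈ imaginary K γ := rfl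

/-- The commutator map `x ↦ a * x - x * a`. -/
def ad (a : Octonion K γ) : Module.End K (Octonion K γ) :=
  LinearMap.mulLeft K a - LinearMap.mulRight K a

theorem ad_apply (a x : Octonion K γ) : ad a x = a * x - x * a := rfl

theorem smul_ad (c : K) (a : Octonion K γ) : c • ad a = ad (c • a) := by
  ext1 x
  rw [LinearMap.smul_apply, ad_apply, ad_apply, smul_sub, smul_mul_assoc, mul_smul_comm]

variable (K γ) in
/-- The ring of maps generated by the commutators with imaginary octonions. Applied entrywise,
its elements act on skew-Hermitian matrices through repeated commutators with `a • 1`. -/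
def adRing : NonUnitalSubring (Module.End K (Octonion K γ)) :=
  NonUnitalSubring.closure (ad '' imaginary K γ)

theorem smul_mem_adRing {T : Module.End K (Octonion K γ)} (hT : T ∈ adRing K γ) (c : K) :
    c • T ∈ adRing K γ := by
  induction hT using NonUnitalSubring.closure_induction with
  | mem _ h =>
    obtain ⟨a, ha, rfl⟩ := h
    rw [smul_ad]
    exact NonUnitalSubring.subset_closure ⟨c • a, (imaginary K γ).smul_mem c ha, rfl⟩
  | zero => rw [smul_zero]; exact zero_mem _
  | add _ _ _ _ hS hT => rw [smul_add]; exact add_mem hS hT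
  | neg _ _ hT => rw [smul_neg]; exact neg_mem hT
  | mul S T _ hT_mem hS _ => rw [← smul_mul_assoc]; exact mul_mem hS hT_mem

theorem mem_adRing_of_smul_mem {T : Module.End K (Octonion K γ)} {c : K} (hc : c ≠ 0)
    (hT : c • T ∈ adRing K γ) : T ∈ adRing K γ := by
  simpa only [inv_smul_smul₀ hc] using smul_mem_adRing hT c⁻¹

/-- The rank one map `x ↦ ⟨a, x⟩ b`. -/
def rankOne (a b : Octonion K γ) : Module.End K (Octonion K γ) :=
  (polar a).smulRight b

theorem rankOne_apply (a b x : Octonion K γ) : rankOne a b x = polar a x • b := rfl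

theorem rankOne_mul_rankOne (a b c d : Octonion K γ) :
    rankOne a b * rankOne c d = polar a d • rankOne c b := by
  ext1 x
  rw [Module.End.mul_apply, LinearMap.smul_apply, rankOne_apply, rankOne_apply, rankOne_apply,
    map_smul, smul_eq_mul, mul_comm, mul_smul]

/-- On imaginary octonions `ad a` is twice the cross product with `a`, and this is the polarized
form of `a × (a × x) = ⟨a, x⟩ a - ⟨a, a⟩ x`, where the scalar product is half of `polar`. -/
theorem ad_mul_ad_add_ad_mul_ad {a b : Octonion K γ} (ha : a ∈ imaginary K γ)
    (hb : b ∈ imaginary K γ) :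
    ad a * ad b + ad b * ad a =
      (2 : K) • (rankOne a b + rankOne b a) - (4 * polar a b) • im K γ := by
  have ha₀ : a.fst.re = 0 := ha
  have hb₀ : b.fst.re = 0 := hb
  ext1 x
  apply ext_coord <;>
    simp only [LinearMap.add_apply, LinearMap.sub_apply, LinearMap.smul_apply,
      Module.End.mul_apply, ad_apply, rankOne_apply, im_apply, re_apply, polar,
      LinearMap.mk₂_apply, fst_mul, snd_mul, fst_add, snd_add, fst_sub, snd_sub, fst_smul,
      snd_smul, fst_one, snd_one, Quaternion.re_mul, Quaternion.imI_mul, Quaternion.imJ_mul,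
      Quaternion.imK_mul, Quaternion.re_add, Quaternion.imI_add, Quaternion.imJ_add,
      Quaternion.imK_add, Quaternion.re_sub, Quaternion.imI_sub, Quaternion.imJ_sub,
      Quaternion.imK_sub, Quaternion.re_smul, Quaternion.imI_smul, Quaternion.imJ_smul,
      Quaternion.imK_smul, Quaternion.re_star, Quaternion.imI_star, Quaternion.imJ_star,
      Quaternion.imK_star, Quaternion.re_one, Quaternion.imI_one, Quaternion.imJ_one,
      Quaternion.imK_one, Quaternion.re_zero, Quaternion.imI_zero, Quaternion.imJ_zero,
      Quaternion.imK_zero, smul_eq_mul, ha₀, hb₀] <;>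
    ring

theorem rankOne_add_rankOne_sub_im_mem_adRing [NeZero (2 : K)] {a b : Octonion K γ}
    (ha : a ∈ imaginary K γ) (hb : b ∈ imaginary K γ) :
    rankOne a b + rankOne b a - (2 * polar a b) • im K γ ∈ adRing K γ := by
  have ha_ad := NonUnitalSubring.subset_closure (Set.mem_image_of_mem ad ha)
  have hb_ad := NonUnitalSubring.subset_closure (Set.mem_image_of_mem ad hb)
  have hmem : ad a * ad b + ad b * ad a ∈ adRing K γ :=
    add_mem (mul_mem ha_ad hb_ad) (mul_mem hb_ad ha_ad)
  refine mem_adRing_of_smul_mem (c := 2) two_ne_zero ?_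
  rwa [smul_sub, smul_smul, ← mul_assoc, show (2 * 2 : K) = 4 by norm_num,
    ← ad_mul_ad_add_ad_mul_ad ha hb]

theorem rankOne_mem_adRing_of_orthogonal [NeZero (2 : K)] {a b c : Octonion K γ}
    (ha : a ∈ imaginary K γ) (hb : b ∈ imaginary K γ) (hc : c ∈ imaginary K γ)
    (hab : polar a b = 0) (hbc : polar b c = 0) (hac : polar a c = 0) (hbb : polar b b ≠ 0) :
    rankOne c a ∈ adRing K γ := by
  have hab_mem := rankOne_add_rankOne_sub_im_mem_adRing ha hb
  have hbc_mem := rankOne_add_rankOne_sub_im_mem_adRing hb hc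
  rw [hab, mul_zero, zero_smul, sub_zero] at hab_mem
  rw [hbc, mul_zero, zero_smul, sub_zero] at hbc_mem
  refine mem_adRing_of_smul_mem hbb ?_
  simpa only [add_mul, mul_add, rankOne_mul_rankOne, hab, hac, hbc, zero_smul, add_zero, zero_add,
    polar_comm b a] using mul_mem hab_mem hbc_mem

theorem polar_unitI_unitI : polar (unitI γ) (unitI γ) = 2 := by simp [polar, unitI]
theorem polar_unitJ_unitJ : polar (unitJ γ) (unitJ γ) = 2 := by simp [polar, unitJ]
theorem polar_unitK_unitK : polar (unitK γ) (unitK γ) = 2 := by simp [polar, unitK]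
theorem polar_unitI_unitJ : polar (unitI γ) (unitJ γ) = 0 := by simp [polar, unitI, unitJ]
theorem polar_unitI_unitK : polar (unitI γ) (unitK γ) = 0 := by simp [polar, unitI, unitK]
theorem polar_unitJ_unitK : polar (unitJ γ) (unitK γ) = 0 := by simp [polar, unitJ, unitK]

theorem rankOne_unitI_unitI_mem_adRing [NeZero (2 : K)] :
    rankOne (unitI γ) (unitI γ) ∈ adRing K γ := by
  have hkk : polar (unitK γ) (unitK γ) ≠ 0 := polar_unitK_unitK.trans_ne two_ne_zero
  have hij : rankOne (unitI γ) (unitJ γ) ∈ adRing K γ :=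
    rankOne_mem_adRing_of_orthogonal unitJ_mem_imaginary unitK_mem_imaginary unitI_mem_imaginary
      polar_unitJ_unitK (by rw [polar_comm, polar_unitI_unitK])
      (by rw [polar_comm, polar_unitI_unitJ]) hkk
  have hji : rankOne (unitJ γ) (unitI γ) ∈ adRing K γ :=
    rankOne_mem_adRing_of_orthogonal unitI_mem_imaginary unitK_mem_imaginary unitJ_mem_imaginary
      polar_unitI_unitK (by rw [polar_comm, polar_unitJ_unitK]) polar_unitI_unitJ hkk
  refine mem_adRing_of_smul_mem (c := 2) two_ne_zero ?_
  rw [← polar_unitJ_unitJ (γ := γ), ← rankOne_mul_rankOne]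
  exact mul_mem hji hij

theorem im_mem_adRing [NeZero (2 : K)] : im K γ ∈ adRing K γ := by
  have hI := rankOne_unitI_unitI_mem_adRing (γ := γ)
  have hmem := sub_mem (add_mem hI hI)
    (rankOne_add_rankOne_sub_im_mem_adRing unitI_mem_imaginary unitI_mem_imaginary)
  rw [sub_sub_cancel, polar_unitI_unitI] at hmem
  exact mem_adRing_of_smul_mem (mul_ne_zero two_ne_zero two_ne_zero) hmem

theorem rankOne_add_rankOne_mem_adRing [NeZero (2 : K)] {a b : Octonion K γ}
    (ha : a ∈ imaginary K γ) (hb : b ∈ imaginary K γ) :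
    rankOne a b + rankOne b a ∈ adRing K γ := by
  have hmem := add_mem (rankOne_add_rankOne_sub_im_mem_adRing ha hb)
    (smul_mem_adRing im_mem_adRing (2 * polar a b))
  rwa [sub_add_cancel] at hmem

theorem rankOne_unitI_left_mem_adRing [NeZero (2 : K)] {a : Octonion K γ}
    (ha : a ∈ imaginary K γ) : rankOne (unitI γ) a ∈ adRing K γ := by
  have hI := rankOne_unitI_unitI_mem_adRing (γ := γ)
  have hmem := sub_mem (mul_mem (rankOne_add_rankOne_mem_adRing unitI_mem_imaginary ha) hI)
    (smul_mem_adRing hI (polar a (unitI γ)))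
  rw [add_mul, rankOne_mul_rankOne, rankOne_mul_rankOne, add_sub_cancel_right,
    polar_unitI_unitI] at hmem
  exact mem_adRing_of_smul_mem two_ne_zero hmem

theorem rankOne_mem_adRing [NeZero (2 : K)] {a b : Octonion K γ} (ha : a ∈ imaginary K γ)
    (hb : b ∈ imaginary K γ) : rankOne a b ∈ adRing K γ := by
  have ha_right : rankOne a (unitI γ) ∈ adRing K γ := by
    have hmem := sub_mem (rankOne_add_rankOne_mem_adRing unitI_mem_imaginary ha)
      (rankOne_unitI_left_mem_adRing ha)
    rwa [add_sub_cancel_left] at hmem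
  refine mem_adRing_of_smul_mem (c := 2) two_ne_zero ?_
  rw [← polar_unitI_unitI (γ := γ), ← rankOne_mul_rankOne]
  exact mul_mem (rankOne_unitI_left_mem_adRing hb) ha_right

theorem unitI_mul_unitJ : unitI γ * unitJ γ = unitK γ := by
  apply ext_coord <;> simp <;> simp [unitI, unitJ, unitK]

theorem unitJ_mul_unitI : unitJ γ * unitI γ = -unitK γ := by
  apply ext_coord <;> simp <;> simp [unitI, unitJ, unitK]

theorem unitI_mul_unitI : unitI γ * unitI γ = -1 := by
  apply ext_coord <;> simp <;> simp [unitI]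

theorem ne_zero_of_polar_self_ne_zero {x : Octonion K γ} (hx : polar x x ≠ 0) : x ≠ 0 := by
  rintro rfl
  exact hx (map_zero _)

theorem unitI_ne_zero [NeZero (2 : K)] : unitI γ ≠ 0 :=
  ne_zero_of_polar_self_ne_zero (polar_unitI_unitI.trans_ne two_ne_zero)

theorem ad_unitI_unitJ_ne_zero [NeZero (2 : K)] : ad (unitI γ) (unitJ γ) ≠ 0 := by
  rw [ad_apply, unitI_mul_unitJ, unitJ_mul_unitI, sub_neg_eq_add, ← two_smul K]
  exact smul_ne_zero two_ne_zero
    (ne_zero_of_polar_self_ne_zero (polar_unitK_unitK.trans_ne two_ne_zero))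
end Octonion

/-! ### Tensors of scalar matrices with octonions -/

section TmulMatrix

open Matrix

variable {K R n : Type*} [CommRing K] [AddCommGroup R] [Module K R]

/-- The matrix `S ⊗ a` with entries `S p q • a`, as a linear function of `S`. -/
def tmulMatrix (a : R) : Matrix n n K →ₗ[K] Matrix n n R :=
  (LinearMap.toSpanSingleton K R a).mapMatrix

theorem tmulMatrix_apply (a : R) (S : Matrix n n K) (p q : n) :
    tmulMatrix a S p q = S p q • a := rfl

theorem tmulMatrix_smul (c : K) (a : R) (S : Matrix n n K) :
    tmulMatrix (c • a) S = c • tmulMatrix a S := by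
  ext p q
  exact smul_comm _ _ _

theorem tmulMatrix_neg (a : R) (S : Matrix n n K) : tmulMatrix (-a) S = -tmulMatrix a S := by
  ext p q
  exact smul_neg _ _

theorem tmulMatrix_injective [IsDomain K] [Module.IsTorsionFree K R] {a : R} (ha : a ≠ 0) :
    Function.Injective (tmulMatrix a : Matrix n n K → Matrix n n R) := fun _ _ hST =>
  Matrix.ext fun p q => smul_left_injective K ha (congrFun₂ hST p q)

theorem mapMatrix_tmulMatrix (T : Module.End K R) (a : R) (S : Matrix n n K) :
    T.mapMatrix (tmulMatrix a S) = tmulMatrix (T a) S := by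
  ext p q
  exact map_smul T _ _

theorem tmulMatrix_one_eq_diagonal [DecidableEq n] (a : R) :
    tmulMatrix a (1 : Matrix n n K) = diagonal fun _ => a := by
  ext p q
  rw [tmulMatrix_apply, one_apply, diagonal_apply, ite_smul, one_smul, zero_smul]

theorem tmulMatrix_mul_tmulMatrix {R : Type*} [NonUnitalNonAssocRing R] [Module K R]
    [IsScalarTower K R R] [SMulCommClass K R R] [Fintype n] (a b : R) (S T : Matrix n n K) :
    tmulMatrix a S * tmulMatrix b T = tmulMatrix (a * b) (S * T) := by
  ext p q
  simp only [mul_apply, tmulMatrix_apply, smul_mul_smul_comm, Finset.sum_smul]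

end TmulMatrix

/-! ### Symmetric and skew-symmetric matrices -/

section SymmSkew

open Matrix

variable {R n : Type*} [CommRing R] [Fintype n] [DecidableEq n]

theorem lie_single_one_apply (A : Matrix n n R) (p r s : n) :
    ⁅single p p (1 : R), A⁆ r s = (if r = p then A r s else 0) - if s = p then A r s else 0 := by
  rw [Ring.lie_def, Matrix.sub_apply]
  congr 1
  · split_ifs with hr
    · rw [hr, single_mul_apply_same, one_mul]
    · exact single_mul_apply_of_ne _ _ _ _ _ hr A
  · split_ifs with hs
    · rw [hs, mul_single_apply_same, mul_one]
    · exact mul_single_apply_of_ne _ _ _ _ _ hs A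

theorem isSymm_lie_single_one {A : Matrix n n R} (hA : Aᵀ = -A) (p : n) :
    ⁅single p p (1 : R), A⁆.IsSymm := by
  rw [IsSymm, Ring.lie_def, transpose_sub, transpose_mul, transpose_mul, transpose_single, hA]
  noncomm_ring

theorem sum_lie_lie_single_one [NoZeroDivisors R] [NeZero (2 : R)] {A : Matrix n n R}
    (hA : Aᵀ = -A) :
    ∑ p : n, ⁅single p p (1 : R), ⁅single p p (1 : R), A⁆⁆ = (2 : R) • A := by
  have hdiag (p : n) : A p p = 0 := by
    have hpp : A p p = -A p p := congrFun₂ hA p p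
    exact (mul_eq_zero_iff_left two_ne_zero).1 (by rw [two_mul, ← eq_neg_iff_add_eq_zero, ← hpp])
  ext r s
  simp only [Matrix.sum_apply, lie_single_one_apply, Matrix.smul_apply, smul_eq_mul]
  rcases eq_or_ne r s with rfl | hrs
  · simp [hdiag]
  · simp [Finset.sum_sub_distrib, hrs, hrs.symm]
    ring

theorem commute_single_one_of_isSymm_of_skew {K : Type*} [Field K] [NeZero (2 : K)]
    {S : Matrix n n K} (hsymm : ∀ B : Matrix n n K, B.IsSymm → Commute B S)
    (hskew : ∀ A : Matrix n n K, Aᵀ = -A → Commute A S) (p q : n) :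
    Commute (single p q 1) S := by
  have hadd := hsymm (single p q 1 + single q p 1) (by
    rw [IsSymm, transpose_add, transpose_single, transpose_single, add_comm])
  have hsub := hskew (single p q 1 - single q p 1) (by
    rw [transpose_sub, transpose_single, transpose_single, neg_sub])
  have htwo := hadd.add_left hsub
  rw [add_add_sub_cancel, ← two_smul K] at htwo
  exact (Commute.smul_left_iff₀ two_ne_zero).1 htwo

end SymmSkew

/-! ### Lie ideals of skew-Hermitian octonion matrices -/

section Lie

open Matrix Octonion

variable {K n : Type*} [Field K] {γ : K}

theorem conjTranspose_tmulMatrix_of_mem_imaginary {S : Matrix n n K} (hS : S.IsSymm)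
    {a : Octonion K γ} (ha : a ∈ imaginary K γ) : (tmulMatrix a S)ᴴ = -tmulMatrix a S := by
  ext1 p q
  rw [conjTranspose_apply, tmulMatrix_apply, star_smul', star_eq_neg_of_mem_imaginary ha,
    hS.apply, smul_neg]
  rfl

theorem conjTranspose_tmulMatrix_one {A : Matrix n n K} (hA : Aᵀ = -A) :
    (tmulMatrix (1 : Octonion K γ) A)ᴴ = -tmulMatrix 1 A := by
  ext1 p q
  have hqp : A q p = -A p q := congrFun₂ hA p q
  rw [conjTranspose_apply, tmulMatrix_apply, star_smul', star_one, hqp, neg_smul]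
  rfl

theorem eq_mapMatrix_im_add_tmulMatrix_re (X : Matrix n n (Octonion K γ)) :
    X = (im K γ).mapMatrix X + tmulMatrix 1 ((re K γ).mapMatrix X) := by
  ext1 p q
  exact (sub_add_cancel _ _).symm

theorem transpose_mapMatrix_re {X : Matrix n n (Octonion K γ)} (hX : Xᴴ = -X) :
    ((re K γ).mapMatrix X)ᵀ = -(re K γ).mapMatrix X := by
  ext1 p q
  have hqp : star (X q p) = -X p q := congrFun₂ hX p q
  exact (re_star _).symm.trans ((congrArg (re K γ) hqp).trans (map_neg _ _))

theorem isSymm_mapMatrix_polar {X : Matrix n n (Octonion K γ)} (hX : Xᴴ = -X)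
    {a : Octonion K γ} (ha : a ∈ imaginary K γ) : ((polar a).mapMatrix X).IsSymm := by
  refine IsSymm.ext fun p q => ?_
  have hqp : star (X q p) = -X p q := congrFun₂ hX p q
  have hneg : -polar a (X q p) = -polar a (X p q) := by
    rw [← polar_star_right ha, hqp, map_neg]
  exact neg_injective hneg

variable [Fintype n]

theorem lie_tmulMatrix_one [DecidableEq n] (a : Octonion K γ) (X : Matrix n n (Octonion K γ)) :
    tmulMatrix a (1 : Matrix n n K) * X - X * tmulMatrix a (1 : Matrix n n K) =
      (ad a).mapMatrix X := by
  ext1 p q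
  rw [tmulMatrix_one_eq_diagonal, Matrix.sub_apply, diagonal_mul, mul_diagonal]
  rfl

/-- An additive group of octonion matrices is Lie stable if it contains all commutators of its
elements with skew-Hermitian matrices. The Lie stable groups of skew-Hermitian matrices are the
ideals of the algebra of skew-Hermitian matrices. -/
def IsLieStable (M : AddSubgroup (Matrix n n (Octonion K γ))) : Prop :=
  ∀ X ∈ M, ∀ Y, Yᴴ = -Y → Y * X - X * Y ∈ M

namespace IsLieStable

variable {M : AddSubgroup (Matrix n n (Octonion K γ))}

theorem mapMatrix_mem (hM : IsLieStable M) {X : Matrix n n (Octonion K γ)} (hX : X ∈ M)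
    {T : Module.End K (Octonion K γ)} (hT : T ∈ adRing K γ) : T.mapMatrix X ∈ M := by
  classical
  induction hT using NonUnitalSubring.closure_induction generalizing X with
  | mem _ h =>
    obtain ⟨a, ha, rfl⟩ := h
    rw [← lie_tmulMatrix_one]
    exact hM X hX _ (conjTranspose_tmulMatrix_of_mem_imaginary isSymm_one ha)
  | zero => exact M.zero_mem
  | add _ _ _ _ hS hT => exact M.add_mem (hS hX) (hT hX)
  | neg _ _ hT => exact M.neg_mem (hT hX)
  | mul _ _ _ _ hS hT => exact hS (hT hX)

variable (M) in
/-- The scalar matrices `S` such that `M` contains `S ⊗ a` for all imaginary `a`. -/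
def imaginaryCoeff : Submodule K (Matrix n n K) where
  carrier := {S | ∀ a ∈ imaginary K γ, tmulMatrix a S ∈ M}
  add_mem' hS hT a ha := by
    rw [map_add]
    exact M.add_mem (hS a ha) (hT a ha)
  zero_mem' a _ := by
    rw [map_zero]
    exact M.zero_mem
  smul_mem' c S hS a ha := by
    rw [map_smul, ← tmulMatrix_smul]
    exact hS _ ((imaginary K γ).smul_mem c ha)

theorem mapMatrix_polar_mem_imaginaryCoeff [NeZero (2 : K)] (hM : IsLieStable M)
    {X : Matrix n n (Octonion K γ)} (hX : X ∈ M) {c : Octonion K γ} (hc : c ∈ imaginary K γ) :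
    (polar c).mapMatrix X ∈ imaginaryCoeff M :=
  fun _ ha => hM.mapMatrix_mem hX (rankOne_mem_adRing hc ha)

theorem mem_imaginaryCoeff [NeZero (2 : K)] (hM : IsLieStable M) {S : Matrix n n K}
    {b : Octonion K γ} (hb : b ∈ imaginary K γ) (hbb : polar b b ≠ 0)
    (hS : tmulMatrix b S ∈ M) : S ∈ imaginaryCoeff M := by
  have hpolar : (polar b).mapMatrix (tmulMatrix b S) = polar b b • S := by
    ext p q
    exact (map_smul (polar b) _ _).trans (mul_comm _ _)
  rw [← Submodule.smul_mem_iff _ hbb, ← hpolar]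
  exact hM.mapMatrix_polar_mem_imaginaryCoeff hS hb

theorem mul_add_mul_mem_imaginaryCoeff [NeZero (2 : K)] (hM : IsLieStable M)
    {S T : Matrix n n K} (hS : S ∈ imaginaryCoeff M) (hT : T.IsSymm) :
    S * T + T * S ∈ imaginaryCoeff M := by
  refine hM.mem_imaginaryCoeff unitK_mem_imaginary (polar_unitK_unitK.trans_ne two_ne_zero) ?_
  have hmem := hM _ (hS _ unitJ_mem_imaginary) _
    (conjTranspose_tmulMatrix_of_mem_imaginary hT unitI_mem_imaginary)
  rwa [tmulMatrix_mul_tmulMatrix, tmulMatrix_mul_tmulMatrix, unitI_mul_unitJ, unitJ_mul_unitI,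
    tmulMatrix_neg, sub_neg_eq_add, ← map_add, add_comm] at hmem

theorem exists_isSymm_mem_imaginaryCoeff_of_real [NeZero (2 : K)] (hM : IsLieStable M)
    {A : Matrix n n K} (hA_mem : tmulMatrix 1 A ∈ M) (hA : Aᵀ = -A) (hA0 : A ≠ 0) :
    ∃ S ∈ imaginaryCoeff M, S.IsSymm ∧ S ≠ 0 := by
  classical
  obtain ⟨p, hp⟩ : ∃ p, ⁅single p p (1 : K), A⁆ ≠ 0 := by
    by_contra! h
    refine smul_ne_zero (two_ne_zero (α := K)) hA0 ?_
    rw [← sum_lie_lie_single_one hA]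
    exact Finset.sum_eq_zero fun p _ => by rw [h p, Ring.lie_def, mul_zero, zero_mul, sub_zero]
  refine ⟨_, ?_, isSymm_lie_single_one hA p, hp⟩
  refine hM.mem_imaginaryCoeff unitI_mem_imaginary (polar_unitI_unitI.trans_ne two_ne_zero) ?_
  have hmem := hM _ hA_mem _ (conjTranspose_tmulMatrix_of_mem_imaginary
    (transpose_single p p (1 : K)) unitI_mem_imaginary)
  rwa [tmulMatrix_mul_tmulMatrix, tmulMatrix_mul_tmulMatrix, mul_one, one_mul, ← map_sub] at hmem

theorem exists_isSymm_mem_imaginaryCoeff [NeZero (2 : K)] (hM : IsLieStable M) (hγ : γ ≠ 0)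
    {X : Matrix n n (Octonion K γ)} (hX : X ∈ M) (hX_skew : Xᴴ = -X) (hX0 : X ≠ 0) :
    ∃ S ∈ imaginaryCoeff M, S.IsSymm ∧ S ≠ 0 := by
  by_cases him : (im K γ).mapMatrix X = 0
  · have hX_re : X = tmulMatrix 1 ((re K γ).mapMatrix X) := by
      conv_lhs => rw [eq_mapMatrix_im_add_tmulMatrix_re X, him, zero_add]
    have hA : (re K γ).mapMatrix X ≠ 0 := by
      intro hA
      rw [hA, map_zero] at hX_re
      exact hX0 hX_re
    exact hM.exists_isSymm_mem_imaginaryCoeff_of_real (hX_re ▸ hX) (transpose_mapMatrix_re hX_skew)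
      hA
  · obtain ⟨p, q, hpq⟩ : ∃ p q, im K γ (X p q) ≠ 0 := by
      by_contra! h
      exact him (Matrix.ext h)
    obtain ⟨a, ha, hpolar⟩ := exists_imaginary_polar_ne_zero hγ hpq
    exact ⟨_, hM.mapMatrix_polar_mem_imaginaryCoeff hX ha, isSymm_mapMatrix_polar hX_skew ha,
      fun h => hpolar (congrFun₂ h p q)⟩

theorem one_mem_imaginaryCoeff [NeZero (2 : K)] [DecidableEq n] (hM : IsLieStable M) (hγ : γ ≠ 0)
    {X : Matrix n n (Octonion K γ)} (hX : X ∈ M) (hX_skew : Xᴴ = -X) (hX0 : X ≠ 0) :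
    1 ∈ imaginaryCoeff M := by
  let _ : StarRing K := starRingOfComm
  obtain ⟨S, hS, hS_symm, hS0⟩ := hM.exists_isSymm_mem_imaginaryCoeff hγ hX hX_skew hX0
  have hJ : IsJordanStable (imaginaryCoeff M) := fun S hS T hT =>
    hM.mul_add_mul_mem_imaginaryCoeff hS hT
  refine hJ.one_mem (fun a _ => ⟨a, (mul_one a).symm⟩) (fun a ha => ⟨(2 * a)⁻¹, ?_⟩) hS hS_symm hS0
  change a * (2 * a)⁻¹ + (2 * a)⁻¹ * a = 1
  field_simp
  norm_num

theorem mapMatrix_mem_of_one_mem [DecidableEq n] (hM : IsLieStable M) (hone : 1 ∈ imaginaryCoeff M)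
    {T : Module.End K (Octonion K γ)} (hT : T ∈ adRing K γ)
    {Y : Matrix n n (Octonion K γ)} (hY : Yᴴ = -Y) : T.mapMatrix Y ∈ M := by
  induction hT using NonUnitalSubring.closure_induction with
  | mem _ h =>
    obtain ⟨a, ha, rfl⟩ := h
    rw [← lie_tmulMatrix_one, ← neg_sub]
    exact M.neg_mem (hM _ (hone a ha) Y hY)
  | zero => exact M.zero_mem
  | add _ _ _ _ hS hT => exact M.add_mem hS hT
  | neg _ _ hT => exact M.neg_mem hT
  | mul _ _ hS_mem _ _ hT => exact hM.mapMatrix_mem hT hS_mem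

theorem isSymm_mem_imaginaryCoeff [NeZero (2 : K)] [DecidableEq n] (hM : IsLieStable M)
    (hone : 1 ∈ imaginaryCoeff M) {S : Matrix n n K} (hS : S.IsSymm) :
    S ∈ imaginaryCoeff M := fun a ha => by
  rw [← im_of_mem_imaginary ha, ← mapMatrix_tmulMatrix]
  exact hM.mapMatrix_mem_of_one_mem hone im_mem_adRing
    (conjTranspose_tmulMatrix_of_mem_imaginary hS ha)

theorem tmulMatrix_one_lie_mem [NeZero (2 : K)] [DecidableEq n] (hM : IsLieStable M)
    (hone : 1 ∈ imaginaryCoeff M) {S T : Matrix n n K} (hS : S.IsSymm) (hT : T.IsSymm) :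
    tmulMatrix 1 ⁅S, T⁆ ∈ M := by
  have hmem := hM _ (hM.isSymm_mem_imaginaryCoeff hone hT _ unitI_mem_imaginary) _
    (conjTranspose_tmulMatrix_of_mem_imaginary hS unitI_mem_imaginary)
  rwa [tmulMatrix_mul_tmulMatrix, tmulMatrix_mul_tmulMatrix, unitI_mul_unitI, ← map_sub,
    tmulMatrix_neg, neg_mem_iff] at hmem

theorem tmulMatrix_one_mem [NeZero (2 : K)] [DecidableEq n] (hM : IsLieStable M)
    (hone : 1 ∈ imaginaryCoeff M) {A : Matrix n n K} (hA : Aᵀ = -A) : tmulMatrix 1 A ∈ M := by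
  have hA_half : ((2⁻¹ : K) • A)ᵀ = -((2⁻¹ : K) • A) := by rw [transpose_smul, hA, smul_neg]
  rw [← smul_inv_smul₀ (two_ne_zero (α := K)) A, ← sum_lie_lie_single_one hA_half, map_sum]
  exact sum_mem fun p _ => hM.tmulMatrix_one_lie_mem hone (transpose_single p p (1 : K))
    (isSymm_lie_single_one hA_half p)

theorem mem_of_conjTranspose_eq_neg [NeZero (2 : K)] (hM : IsLieStable M) (hγ : γ ≠ 0)
    {X : Matrix n n (Octonion K γ)} (hX : X ∈ M) (hX_skew : Xᴴ = -X) (hX0 : X ≠ 0)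
    {Y : Matrix n n (Octonion K γ)} (hY : Yᴴ = -Y) : Y ∈ M := by
  classical
  have hone := hM.one_mem_imaginaryCoeff hγ hX hX_skew hX0
  rw [eq_mapMatrix_im_add_tmulMatrix_re Y]
  exact M.add_mem (hM.mapMatrix_mem_of_one_mem hone im_mem_adRing hY)
    (hM.tmulMatrix_one_mem hone (transpose_mapMatrix_re hY))

end IsLieStable

end Lie

/-! ### Skew-Hermitian octonion matrices -/

namespace SkewHermitianOctonion

open Matrix Octonion

variable {K : Type*} [Field K] {γ : K} {n : ℕ}

/-- An ideal of the algebra of skew-Hermitian matrices, as a group of octonion matrices. -/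
def idealToAddSubgroup (I : TwoSidedIdeal (SkewHermitianOctonion K γ n)) :
    AddSubgroup (Matrix (Fin n) (Fin n) (Octonion K γ)) where
  carrier := {X | ∃ x ∈ I, (x : Matrix (Fin n) (Fin n) (Octonion K γ)) = X}
  add_mem' := by
    rintro _ _ ⟨x, hx, rfl⟩ ⟨y, hy, rfl⟩
    exact ⟨x + y, I.add_mem hx hy, rfl⟩
  zero_mem' := ⟨0, I.zero_mem, rfl⟩
  neg_mem' := by
    rintro _ ⟨x, hx, rfl⟩
    exact ⟨-x, I.neg_mem hx, rfl⟩

theorem coe_mem_idealToAddSubgroup {I : TwoSidedIdeal (SkewHermitianOctonion K γ n)}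
    {x : SkewHermitianOctonion K γ n} : x.1 ∈ idealToAddSubgroup I ↔ x ∈ I :=
  ⟨fun ⟨_, hy, hyx⟩ => Subtype.ext hyx ▸ hy, fun hx => ⟨x, hx, rfl⟩⟩

theorem isLieStable_idealToAddSubgroup (I : TwoSidedIdeal (SkewHermitianOctonion K γ n)) :
    IsLieStable (idealToAddSubgroup I) := by
  rintro _ ⟨x, hx, rfl⟩ Y hY
  exact ⟨_, I.mul_mem_left ⟨Y, hY⟩ x hx, rfl⟩

theorem ideal_eq_top [NeZero (2 : K)] (hγ : γ ≠ 0)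
    {I : TwoSidedIdeal (SkewHermitianOctonion K γ n)} (hI : I ≠ ⊥) : I = ⊤ := by
  obtain ⟨x, hx, hx0⟩ := exists_mem_ne_zero_of_ne_bot hI
  refine eq_top_iff.2 fun y _ => coe_mem_idealToAddSubgroup.1 ?_
  exact (isLieStable_idealToAddSubgroup I).mem_of_conjTranspose_eq_neg hγ
    (coe_mem_idealToAddSubgroup.2 hx) x.2 (fun h => hx0 (Subtype.ext h)) y.2

theorem exists_coe_eq_mapMatrix_and_centroidHom_apply
    (φ : CentroidHom (SkewHermitianOctonion K γ n)) {T : Module.End K (Octonion K γ)}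
    (hT : T ∈ adRing K γ) (x : SkewHermitianOctonion K γ n) :
    ∃ y : SkewHermitianOctonion K γ n, y.1 = T.mapMatrix x.1 ∧ (φ y).1 = T.mapMatrix (φ x).1 := by
  induction hT using NonUnitalSubring.closure_induction generalizing x with
  | mem _ h =>
    obtain ⟨a, ha, rfl⟩ := h
    let a_one : SkewHermitianOctonion K γ n :=
      ⟨tmulMatrix a 1, conjTranspose_tmulMatrix_of_mem_imaginary isSymm_one ha⟩
    refine ⟨a_one * x, lie_tmulMatrix_one a x.1, ?_⟩
    rw [map_mul_left]
    exact lie_tmulMatrix_one a (φ x).1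
  | zero => exact ⟨0, rfl, congrArg Subtype.val (map_zero φ)⟩
  | add _ _ _ _ hS hT =>
    obtain ⟨y, hy, hφy⟩ := hS x
    obtain ⟨z, hz, hφz⟩ := hT x
    refine ⟨y + z, congrArg₂ (· + ·) hy hz, ?_⟩
    rw [map_add]
    exact congrArg₂ (· + ·) hφy hφz
  | neg _ _ hT =>
    obtain ⟨y, hy, hφy⟩ := hT x
    refine ⟨-y, congrArg Neg.neg hy, ?_⟩
    rw [map_neg]
    exact congrArg Neg.neg hφy
  | mul S T _ _ hS hT =>
    obtain ⟨y, hy, hφy⟩ := hT x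
    obtain ⟨z, hz, hφz⟩ := hS y
    exact ⟨z, hz.trans (congrArg S.mapMatrix hy), hφz.trans (congrArg S.mapMatrix hφy)⟩

variable (K γ n) in
/-- The skew-Hermitian matrix `i • 1`, whose line is invariant under the centroid. -/
def unitIOne : SkewHermitianOctonion K γ n :=
  ⟨tmulMatrix (unitI γ) 1,
    conjTranspose_tmulMatrix_of_mem_imaginary isSymm_one unitI_mem_imaginary⟩

theorem unitIOne_ne_zero [NeZero (2 : K)] (hn : 1 ≤ n) : unitIOne K γ n ≠ 0 := fun h =>
  have : NeZero n := ⟨by lia⟩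
  one_ne_zero (tmulMatrix_injective unitI_ne_zero
    ((congrArg Subtype.val h).trans (map_zero _).symm) : (1 : Matrix (Fin n) (Fin n) K) = 0)

theorem exists_centroidHom_unitIOne_eq_tmulMatrix [NeZero (2 : K)]
    (φ : CentroidHom (SkewHermitianOctonion K γ n)) :
    ∃ S : Matrix (Fin n) (Fin n) K, (φ (unitIOne K γ n)).1 = tmulMatrix (unitI γ) S := by
  let T := rankOne ((2⁻¹ : K) • unitI γ) (unitI γ)
  have hT : T ∈ adRing K γ :=
    rankOne_mem_adRing ((imaginary K γ).smul_mem _ unitI_mem_imaginary) unitI_mem_imaginary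
  have hT_unitI : T (unitI γ) = unitI γ := by
    rw [rankOne_apply, map_smul, LinearMap.smul_apply, polar_unitI_unitI, smul_eq_mul,
      inv_mul_cancel₀ two_ne_zero, one_smul]
  obtain ⟨y, hy, hφy⟩ := exists_coe_eq_mapMatrix_and_centroidHom_apply φ hT (unitIOne K γ n)
  obtain rfl : y = unitIOne K γ n :=
    Subtype.ext (hy.trans ((mapMatrix_tmulMatrix T _ 1).trans (congrArg (tmulMatrix · 1) hT_unitI)))
  exact ⟨(polar ((2⁻¹ : K) • unitI γ)).mapMatrix (φ (unitIOne K γ n)).1, hφy⟩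

theorem commute_centroidHom (φ : CentroidHom (SkewHermitianOctonion K γ n))
    {x y : SkewHermitianOctonion K γ n} (hxy : Commute x.1 y.1) :
    Commute (φ x).1 y.1 := by
  have hmul : x * y = 0 := Subtype.ext (sub_eq_zero.2 hxy)
  have hφ : φ x * y = 0 := by rw [← map_mul_right, hmul, map_zero]
  exact sub_eq_zero.1 (congrArg Subtype.val hφ)

theorem exists_centroidHom_unitIOne_eq_smul [NeZero (2 : K)]
    (φ : CentroidHom (SkewHermitianOctonion K γ n)) :
    ∃ c : K, φ (unitIOne K γ n) = c • unitIOne K γ n := by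
  obtain ⟨S, hS⟩ := exists_centroidHom_unitIOne_eq_tmulMatrix φ
  have hsymm (B : Matrix (Fin n) (Fin n) K) (hB : B.IsSymm) : Commute B S := by
    have hcomm := commute_centroidHom φ (x := unitIOne K γ n)
      (y := ⟨_, conjTranspose_tmulMatrix_of_mem_imaginary hB unitI_mem_imaginary⟩)
      (by simp only [unitIOne, Commute, SemiconjBy, tmulMatrix_mul_tmulMatrix, one_mul, mul_one])
    rw [hS, Commute, SemiconjBy, tmulMatrix_mul_tmulMatrix, tmulMatrix_mul_tmulMatrix,
      unitI_mul_unitI] at hcomm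
    exact (tmulMatrix_injective (neg_ne_zero.2 one_ne_zero) hcomm).symm
  have hskew (A : Matrix (Fin n) (Fin n) K) (hA : Aᵀ = -A) : Commute A S := by
    have hcomm := commute_centroidHom φ (x := unitIOne K γ n)
      (y := ⟨_, conjTranspose_tmulMatrix_one hA⟩)
      (by simp only [unitIOne, Commute, SemiconjBy, tmulMatrix_mul_tmulMatrix, one_mul, mul_one])
    rw [hS, Commute, SemiconjBy, tmulMatrix_mul_tmulMatrix, tmulMatrix_mul_tmulMatrix, one_mul,
      mul_one] at hcomm
    exact (tmulMatrix_injective unitI_ne_zero hcomm).symm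
  obtain ⟨c, rfl⟩ := mem_range_scalar_of_commute_single fun p q _ =>
    commute_single_one_of_isSymm_of_skew hsymm hskew p q
  refine ⟨c, Subtype.ext (hS.trans ?_)⟩
  rw [scalar_apply, ← smul_one_eq_diagonal, map_smul]
  rfl

theorem exists_mul_ne_zero [NeZero (2 : K)] (hn : 1 ≤ n) :
    ∃ x y : SkewHermitianOctonion K γ n, x * y ≠ 0 := by
  refine ⟨unitIOne K γ n,
    ⟨_, conjTranspose_tmulMatrix_of_mem_imaginary isSymm_one unitJ_mem_imaginary⟩, fun h => ?_⟩
  have : NeZero n := ⟨by lia⟩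
  have hlie : tmulMatrix (ad (unitI γ) (unitJ γ)) (1 : Matrix (Fin n) (Fin n) K) = 0 := by
    rw [← mapMatrix_tmulMatrix, ← lie_tmulMatrix_one]
    exact congrArg Subtype.val h
  exact one_ne_zero (tmulMatrix_injective ad_unitI_unitJ_ne_zero (hlie.trans (map_zero _).symm))

theorem isCentralSimpleAlg [NeZero (2 : K)] (hγ : γ ≠ 0) (hn : 1 ≤ n) :
    IsCentralSimpleAlg K (SkewHermitianOctonion K γ n) := by
  have : Nontrivial (SkewHermitianOctonion K γ n) := ⟨_, _, unitIOne_ne_zero hn⟩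
  have : IsSimpleRing (SkewHermitianOctonion K γ n) :=
    IsSimpleRing.of_eq_bot_or_eq_top fun I => or_iff_not_imp_left.2 (ideal_eq_top hγ)
  exact .of_eigenvector (exists_mul_ne_zero hn) (unitIOne_ne_zero hn)
    exists_centroidHom_unitIOne_eq_smul

end SkewHermitianOctonion

/-! ### Hermitian octonion matrices -/

namespace HermitianOctonion

open Matrix Octonion

variable {K : Type*} [Field K] {γ : K} {n : ℕ}

theorem coe_mul (x y : HermitianOctonion K γ n) :
    (x * y).1 = (2⁻¹ : K) • (x.1 * y.1 + y.1 * x.1) := rfl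

theorem smul_mem_ideal [NeZero (2 : K)] {I : TwoSidedIdeal (HermitianOctonion K γ n)} (c : K)
    {x : HermitianOctonion K γ n} (hx : x ∈ I) : c • x ∈ I := by
  let one : HermitianOctonion K γ n := ⟨1, conjTranspose_one⟩
  have hone : one * x = x := by
    refine Subtype.ext ?_
    rw [coe_mul, one_mul, mul_one, ← two_smul K, inv_smul_smul₀ two_ne_zero]
  rw [← hone, ← smul_mul_assoc]
  exact I.mul_mem_left _ x hx

/-- An ideal of the algebra of Hermitian matrices, as a space of octonion matrices. -/
def idealToSubmodule [NeZero (2 : K)] (I : TwoSidedIdeal (HermitianOctonion K γ n)) :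
    Submodule K (Matrix (Fin n) (Fin n) (Octonion K γ)) where
  carrier := {X | ∃ x ∈ I, (x : Matrix (Fin n) (Fin n) (Octonion K γ)) = X}
  add_mem' := by
    rintro _ _ ⟨x, hx, rfl⟩ ⟨y, hy, rfl⟩
    exact ⟨x + y, I.add_mem hx hy, rfl⟩
  zero_mem' := ⟨0, I.zero_mem, rfl⟩
  smul_mem' := by
    rintro c _ ⟨x, hx, rfl⟩
    exact ⟨c • x, smul_mem_ideal c hx, rfl⟩

theorem coe_mem_idealToSubmodule [NeZero (2 : K)] {I : TwoSidedIdeal (HermitianOctonion K γ n)}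
    {x : HermitianOctonion K γ n} : x.1 ∈ idealToSubmodule I ↔ x ∈ I :=
  ⟨fun ⟨_, hy, hyx⟩ => Subtype.ext hyx ▸ hy, fun hx => ⟨x, hx, rfl⟩⟩

theorem isJordanStable_idealToSubmodule [NeZero (2 : K)]
    (I : TwoSidedIdeal (HermitianOctonion K γ n)) : IsJordanStable (idealToSubmodule I) := by
  rintro _ ⟨x, hx, rfl⟩ T hT
  rw [← smul_inv_smul₀ (two_ne_zero (α := K)) (x.1 * T + T * x.1)]
  exact (idealToSubmodule I).smul_mem 2 ⟨_, I.mul_mem_right x ⟨T, hT⟩ hx, rfl⟩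

theorem ideal_eq_top [NeZero (2 : K)] (hγ : γ ≠ 0)
    {I : TwoSidedIdeal (HermitianOctonion K γ n)} (hI : I ≠ ⊥) : I = ⊤ := by
  obtain ⟨x, hx, hx0⟩ := exists_mem_ne_zero_of_ne_bot hI
  have hJ := isJordanStable_idealToSubmodule I
  have hone : 1 ∈ idealToSubmodule I :=
    hJ.one_mem (fun a ha => ⟨_, eq_re_smul_one_of_star_eq_self ha⟩)
      (fun a ha => exists_mul_star_add_mul_star_eq_one hγ ha) (coe_mem_idealToSubmodule.2 hx) x.2
      (fun h => hx0 (Subtype.ext h))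
  refine eq_top_iff.2 fun y _ => coe_mem_idealToSubmodule.1 ?_
  refine (Submodule.smul_mem_iff _ (two_ne_zero (α := K))).1 ?_
  rw [two_smul]
  simpa only [one_mul, mul_one] using hJ 1 hone y.1 y.2

variable (K γ) in
/-- The diagonal matrix unit `E_pp`, a Hermitian matrix. -/
def diagUnit (p : Fin n) : HermitianOctonion K γ n :=
  ⟨single p p 1, isHermitian_single_one p⟩

theorem diagUnit_ne_zero (p : Fin n) : diagUnit K γ p ≠ 0 := fun h =>
  one_ne_zero (α := Octonion K γ)
    ((single_apply_same p p 1).symm.trans (congrFun₂ (congrArg Subtype.val h) p p))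

theorem diagUnit_mul_self [NeZero (2 : K)] (p : Fin n) :
    diagUnit K γ p * diagUnit K γ p = diagUnit K γ p := by
  refine Subtype.ext ?_
  rw [coe_mul, ← two_smul K, inv_smul_smul₀ two_ne_zero, diagUnit, single_mul_single_same, mul_one]

theorem apply_eq_zero_of_mul_diagUnit_eq_self [NeZero (2 : K)] {p r s : Fin n}
    {x : HermitianOctonion K γ n} (hx : x * diagUnit K γ p = x) (hrs : ¬(p = r ∧ p = s)) :
    x.1 r s = 0 := by
  have htwo : (2 : K) • x.1 r s =
      (if s = p then x.1 r s else 0) + if r = p then x.1 r s else 0 := by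
    rw [← anticommutator_single_one_apply]
    conv_lhs => rw [← hx]
    exact smul_inv_smul₀ two_ne_zero _
  by_cases hr : r = p
  · have hs : s ≠ p := fun hs => hrs ⟨hr.symm, hs.symm⟩
    rwa [if_pos hr, if_neg hs, zero_add, two_smul, add_eq_left] at htwo
  · by_cases hs : s = p
    · rwa [if_neg hr, if_pos hs, add_zero, two_smul, add_eq_left] at htwo
    · rw [if_neg hr, if_neg hs, add_zero] at htwo
      exact (smul_eq_zero_iff_right two_ne_zero).1 htwo

theorem eq_smul_diagUnit_of_mul_eq_self [NeZero (2 : K)] {p : Fin n}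
    {x : HermitianOctonion K γ n} (hx : x * diagUnit K γ p = x) :
    x = re K γ (x.1 p p) • diagUnit K γ p := by
  refine Subtype.ext (Matrix.ext fun r s => ?_)
  change x.1 r s = re K γ (x.1 p p) • single p p 1 r s
  rw [single_apply]
  split_ifs with hrs
  · obtain ⟨rfl, rfl⟩ := hrs
    exact eq_re_smul_one_of_star_eq_self (congrFun₂ x.2 p p)
  · rw [smul_zero, apply_eq_zero_of_mul_diagUnit_eq_self hx hrs]

theorem exists_centroidHom_diagUnit_eq_smul [NeZero (2 : K)]
    (φ : CentroidHom (HermitianOctonion K γ n)) (p : Fin n) :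
    ∃ c : K, φ (diagUnit K γ p) = c • diagUnit K γ p := by
  refine ⟨_, eq_smul_diagUnit_of_mul_eq_self ?_⟩
  rw [← map_mul_right, diagUnit_mul_self]

theorem isCentralSimpleAlg [NeZero (2 : K)] (hγ : γ ≠ 0) (hn : 1 ≤ n) :
    IsCentralSimpleAlg K (HermitianOctonion K γ n) := by
  let p : Fin n := ⟨0, hn⟩
  have : Nontrivial (HermitianOctonion K γ n) := ⟨_, _, diagUnit_ne_zero p⟩
  have : IsSimpleRing (HermitianOctonion K γ n) :=
    IsSimpleRing.of_eq_bot_or_eq_top fun I => or_iff_not_imp_left.2 (ideal_eq_top hγ)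
  refine .of_eigenvector ⟨diagUnit K γ p, diagUnit K γ p, ?_⟩ (diagUnit_ne_zero p)
    fun φ => exists_centroidHom_diagUnit_eq_smul φ p
  rw [diagUnit_mul_self]
  exact diagUnit_ne_zero p

end HermitianOctonion

theorem mainTheorem3_general (K : Type*) [Field K] (h2 : ringChar K ≠ 2) (γ : K) (hγ : γ ≠ 0)
    (n : ℕ) (hn : 1 ≤ n) :
    IsCentralSimpleAlg K (HermitianOctonion K γ n) ∧
      IsCentralSimpleAlg K (SkewHermitianOctonion K γ n) :=
  have : NeZero (2 : K) := ⟨Ring.two_ne_zero h2⟩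
  ⟨HermitianOctonion.isCentralSimpleAlg hγ hn, SkewHermitianOctonion.isCentralSimpleAlg hγ hn⟩

theorem mainTheorem3 (K : Type*) [Field K] (h2 : ringChar K ≠ 2) (h3 : ringChar K ≠ 3)
    (γ : K) (hγ : γ = 1 ∨ γ = -1) (n : ℕ) (hn : 1 ≤ n) :
    IsCentralSimpleAlg K (HermitianOctonion K γ n) ∧
      IsCentralSimpleAlg K (SkewHermitianOctonion K γ n) :=
  mainTheorem3_general K h2 γ (by rcases hγ with rfl | rfl <;> simp) n hn
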